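/- Let $n,N,L\ge 1$ and let $A\in\mathbb{C}^{n\times N}$ have columns $a_1,\dots,a_N$ with $\|a_j\|_2=1$. Let $S\subset\{1,\dots,N\}$ be non-empty, $k=|S|$, and let $$\mu_2(S)=\max\Bigl\{\max_{\ell\notin S}\|A_S^*a_\ell\|_2,\ \max_{\ell\in S}\|A_{S\setminus\{\ell\}}^*a_\ell\|_2\Bigr\}$$ be the local $2$-coherence, where $A_T$ is the submatrix of the columns indexed by $T$ and a maximum over the empty set is $0$. Let $\Sigma=\operatorname{diag}(\sigma_j,\,j\in S)$ with $\sigma_j>0$ and $R=\max_{j\in S}\sigma_j/\min_{j\in S}\sigma_j$. Let $X$ be the random $N\times L$ matrix whose rows outside $S$ are zero and whose rows on $S$ are given by $X^S=\Sigma\Phi$, where the rows of $\Phi\in\mathbb{R}^{k\times L}$ are independent and uniformly distributed on the real unit sphere $S^{L-1}\subset\mathbb{R}^L$ (real spherical model), and let $Y=AX$. The $2$-thresholding algorithm selects a set $T$ of $k$ indices with $\|a_\ell^*Y\|_2\ge\|a_j^*Y\|_2$ for all $\ell\in T$, $j\notin T$ (ties being broken in any way), and outputs $\hat X$ with $\hat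 X^T=A_T^\dagger Y$, $A_T^\dagger=(A_T^*A_T)^{-1}A_T^*$, and zero rows outside $T$. Theorem. If $\theta=2R\,\mu_2(S)<1$, then the probability that $2$-thresholding applied to $Y$ may select a set $T\neq S$ is at most $$N\exp\Bigl(-\tfrac{L}{2}\bigl(\theta^{-2}-\log(\theta^{-2})-1\bigr)\Bigr)$$ (read as $0$ if $\theta=0$). If moreover the columns of $A_S$ are linearly independent, then the probability that $2$-thresholding may return some $\hat X\ne X$ is bounded by the same quantity. If instead $\Phi\in\mathbb{C}^{k\times L}$ has independent rows uniformly distributed on the complex unit sphere of $\mathbb{C}^L$ (complex spherical model), both statements hold with $L/2$ replaced by $L$. -/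

import Mathlib

open MeasureTheory ProbabilityTheory Matrix

noncomputable section

namespace MultichannelThresholding

/-- The uniform probability distribution on the unit sphere of a finite-dimensional normed space
`E`, viewed as a measure on `E`: the normalized surface measure induced by Haar measure. -/
def uniformSphere (E : Type*) [NormedAddCommGroup E] [NormedSpace ℝ E] [FiniteDimensional ℝ E]
    [MeasurableSpace E] [BorelSpace E] : Measure E :=
  (((Measure.addHaar : Measure E).toSphere Set.univ)⁻¹ •
    (Measure.addHaar : Measure E).toSphere).map Subtype.val

/-- The real spherical model: the rows of the random real matrix `Φ` are independent and uniformly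
distributed on the unit sphere of `ℝ^L`. -/
structure IsRealSpherical {Ω ι : Type*} [MeasurableSpace Ω] {L : ℕ}
    (Φ : Ω → Matrix ι (Fin L) ℝ) (P : Measure Ω) : Prop where
  indep : iIndepFun
    (fun (j : ι) (ω : Ω) => (WithLp.toLp 2 (Φ ω j) : EuclideanSpace ℝ (Fin L))) P
  law : ∀ j : ι, HasLaw (fun ω => (WithLp.toLp 2 (Φ ω j) : EuclideanSpace ℝ (Fin L)))
    (uniformSphere (EuclideanSpace ℝ (Fin L))) P

/-- The complex spherical model: the rows of the random complex matrix `Φ` are independent and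
uniformly distributed on the unit sphere of `ℂ^L`. -/
structure IsComplexSpherical {Ω ι : Type*} [MeasurableSpace Ω] {L : ℕ}
    (Φ : Ω → Matrix ι (Fin L) ℂ) (P : Measure Ω) : Prop where
  indep : iIndepFun
    (fun (j : ι) (ω : Ω) => (WithLp.toLp 2 (Φ ω j) : EuclideanSpace ℂ (Fin L))) P
  law : ∀ j : ι, HasLaw (fun ω => (WithLp.toLp 2 (Φ ω j) : EuclideanSpace ℂ (Fin L)))
    (uniformSphere (EuclideanSpace ℂ (Fin L))) P

variable {n N L : ℕ}

/-- The submatrix `A_T` of the columns of `A` indexed by `T`. -/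
def colsOn (A : Matrix (Fin n) (Fin N) ℂ) (T : Finset (Fin N)) : Matrix (Fin n) T ℂ :=
  A.submatrix id Subtype.val

/-- The matrix whose rows indexed by `T` are those of `M`, all other rows being zero. -/
def extendRows (T : Finset (Fin N)) (M : Matrix T (Fin L) ℂ) : Matrix (Fin N) (Fin L) ℂ :=
  Matrix.of fun j l => if h : j ∈ T then M ⟨j, h⟩ l else 0

/-- The coefficient matrix `X` supported on `S` with `X^S = Σ Φ`, `Σ = diag σ`. -/
def coeffMatrix (S : Finset (Fin N)) (σ : S → ℝ) (Φ : Matrix S (Fin L) ℂ) :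
    Matrix (Fin N) (Fin L) ℂ :=
  extendRows S (Matrix.diagonal (fun j => (σ j : ℂ)) * Φ)

/-- The Euclidean norm `‖A_T^* a_ℓ‖₂`. -/
def crossNorm (A : Matrix (Fin n) (Fin N) ℂ) (T : Finset (Fin N)) (ℓ : Fin N) : ℝ :=
  ‖(WithLp.toLp 2 ((colsOn A T)ᴴ *ᵥ A.col ℓ) : EuclideanSpace ℂ T)‖

/-- The local `2`-coherence `μ₂(S)` of `A` (a maximum over an empty set of indices counts as
`0`, which is the value of the real supremum over an empty type). -/
def localCoherence (A : Matrix (Fin n) (Fin N) ℂ) (S : Finset (Fin N)) : ℝ :=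
  max (⨆ ℓ : {ℓ : Fin N // ℓ ∉ S}, crossNorm A S ℓ) (⨆ ℓ : S, crossNorm A (S.erase ℓ) ℓ)

/-- The ratio `max_j σ_j / min_j σ_j` over `j ∈ S`. -/
def dynamicRange {S : Finset (Fin N)} (σ : S → ℝ) : ℝ :=
  (⨆ j, σ j) / (⨅ j, σ j)

/-- The `2`-correlation `‖a_j^* Y‖₂` of the `j`-th column of `A` with `Y`. -/
def correlation (A : Matrix (Fin n) (Fin N) ℂ) (Y : Matrix (Fin n) (Fin L) ℂ) (j : Fin N) : ℝ :=
  ‖(WithLp.toLp 2 (star (A.col j) ᵥ* Y) : EuclideanSpace ℂ (Fin L))‖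

/-- `T` is a set of `k` indices whose `2`-correlations with `Y` are among the `k` largest, i.e. a
support that `2`-thresholding may select (ties can be broken in any way). -/
def IsSelected (A : Matrix (Fin n) (Fin N) ℂ) (Y : Matrix (Fin n) (Fin L) ℂ) (k : ℕ)
    (T : Finset (Fin N)) : Prop :=
  T.card = k ∧ ∀ ℓ ∈ T, ∀ j ∉ T, correlation A Y j ≤ correlation A Y ℓ

/-- The pseudo-inverse `(B^* B)⁻¹ B^*` of a matrix `B` with linearly independent columns. -/
def pinv {m : Type*} [Fintype m] [DecidableEq m] (B : Matrix (Fin n) m ℂ) :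
    Matrix m (Fin n) ℂ :=
  (Bᴴ * B)⁻¹ * Bᴴ

/-- `Z` is an output of `2`-thresholding with sparsity `k` applied to `Y`: for a selected support
`T`, the rows of `Z` on `T` are `A_T^† Y` and its other rows are zero. -/
def IsThresholdingOutput (A : Matrix (Fin n) (Fin N) ℂ) (Y : Matrix (Fin n) (Fin L) ℂ) (k : ℕ)
    (Z : Matrix (Fin N) (Fin L) ℂ) : Prop :=
  ∃ T : Finset (Fin N), IsSelected A Y k T ∧ Z = extendRows T (pinv (colsOn A T) * Y)

/-- `2`-thresholding applied to `Y = A X` may select a support different from `S`. -/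
def SupportFails (A : Matrix (Fin n) (Fin N) ℂ) (S : Finset (Fin N))
    (X : Matrix (Fin N) (Fin L) ℂ) : Prop :=
  ∃ T : Finset (Fin N), IsSelected A (A * X) S.card T ∧ T ≠ S

/-- `2`-thresholding with sparsity `k` applied to `Y = A X` may return an output different
from `X`. -/
def RecoveryFails (A : Matrix (Fin n) (Fin N) ℂ) (k : ℕ) (X : Matrix (Fin N) (Fin L) ℂ) : Prop :=
  ∃ Z : Matrix (Fin N) (Fin L) ℂ, IsThresholdingOutput A (A * X) k Z ∧ Z ≠ X

/-- `N exp (-m (θ⁻² - log θ⁻² - 1))`, with its limit value `0` at `θ = 0`. -/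
def failureBound (N : ℕ) (m θ : ℝ) : ℝ :=
  if θ = 0 then 0
  else N * Real.exp (-(m * ((θ ^ 2)⁻¹ - Real.log (θ ^ 2)⁻¹ - 1)))

end MultichannelThresholding

end

noncomputable section

namespace MultichannelThresholding

/-! ### Polar coordinates, Gaussian radial moments and convexity of `cosh √s` -/

section Sphere

open Module Set

/-! The correlation of an atom `ℓ` with `Y` is `σ_ℓ` (present only if `ℓ ∈ S`) up to the norm of an
interference term, a combination of the other rows of `Φ`. If a wrong support is selected, some
interference has norm at least `min σ / 2` (`SupportFails.exists_interference`). Its coefficient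
vector has norm at most `max σ * μ₂(S) = min σ * θ / 2`, so after normalization a combination of
independent spherical rows with coefficients of norm at most 1 has norm at least `θ⁻¹`. A union
bound over `N` atoms gives the factor `N`.

The tail bound rests on a comparison with Gaussians in real dimension `d`. A Gaussian vector is `r
u` with `u` uniform on the sphere, `r` independent of `u` and `E r² = d`. Jensen for the convex
function `s ↦ cosh (√s y)` gives `E cosh (√d ⟨w, u⟩) ≤ E cosh ⟨w, r u⟩ = exp (‖w‖² / 2)`; by
symmetry `u` is subgaussian with variance proxy `1 / d` (`lintegral_exp_inner_uniformSphere_le`).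
Writing `exp (t ‖Z‖²)` as a Gaussian average of `exp (√(2t) ⟨Z, g⟩)` makes independence usable and
bounds it by `(1 - 2t/d)^(-d/2)`, the chi-square value (`lintegral_exp_sq_norm_sum_le`). Chernoff's
method concludes, with `d = L` in the real model and `d = 2L` in the complex one. -/

lemma mul_sinh_le_mul_sinh {x z : ℝ} (hx : 0 ≤ x) (hxz : x ≤ z) :
    z * Real.sinh x ≤ x * Real.sinh z := by
  refine hasSum_le (fun m => ?_) ((Real.hasSum_sinh x).mul_left z)
    ((Real.hasSum_sinh z).mul_left x)
  have h : x ^ (2 * m) ≤ z ^ (2 * m) := pow_le_pow_left₀ hx hxz _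
  have hz : 0 ≤ z := hx.trans hxz
  rw [← mul_div_assoc, ← mul_div_assoc]
  gcongr ?_ / _
  calc z * x ^ (2 * m + 1) = (x * z) * x ^ (2 * m) := by ring
    _ ≤ (x * z) * z ^ (2 * m) := by gcongr
    _ = x * z ^ (2 * m + 1) := by ring

/-- The tangent line inequality for the convex function `s ↦ cosh √s`. -/
lemma cosh_tangent_le {x z : ℝ} (hx : 0 < x) (hz : 0 ≤ z) :
    Real.cosh x + (z ^ 2 - x ^ 2) * (Real.sinh x / (2 * x)) ≤ Real.cosh z := by
  -- `k` is the slope of `s ↦ cosh √s` at `s = x²`. The derivative of `f` has the sign of `sinh t /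
  -- t - sinh x / x`, and `sinh t / t` is increasing, so `f` is minimal at `x`.
  set k := Real.sinh x / (2 * x) with hk
  let f : ℝ → ℝ := fun t => Real.cosh t - t ^ 2 * k
  have hd : ∀ t, HasDerivAt f (Real.sinh t - 2 * t * k) t := fun t => by
    have := (Real.hasDerivAt_cosh t).fun_sub ((hasDerivAt_pow 2 t).mul_const k)
    simpa using this
  have hkx : 2 * x * k = Real.sinh x := by rw [hk]; field_simp
  have hcont : Continuous f := continuous_iff_continuousAt.2 fun t => (hd t).continuousAt
  suffices f x ≤ f z by simp only [f] at this; linarith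
  rcases le_total x z with h | h
  · refine monotoneOn_of_deriv_nonneg (convex_Ici x) hcont.continuousOn
      (fun t _ => (hd t).differentiableAt.differentiableWithinAt) (fun t ht => ?_)
      (mem_Ici.2 le_rfl) (mem_Ici.2 h) h
    rw [interior_Ici, mem_Ioi] at ht
    rw [(hd t).deriv]
    have := mul_sinh_le_mul_sinh hx.le ht.le
    have h2 : x * (2 * t * k) = t * Real.sinh x := by rw [← hkx]; ring
    have h3 : x * (2 * t * k) ≤ x * Real.sinh t := by linarith
    linarith [le_of_mul_le_mul_left h3 hx]
  · refine antitoneOn_of_deriv_nonpos (convex_Icc 0 x) hcont.continuousOn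
      (fun t _ => (hd t).differentiableAt.differentiableWithinAt) (fun t ht => ?_)
      (mem_Icc.2 ⟨hz, h⟩) (mem_Icc.2 ⟨hx.le, le_rfl⟩) h
    rw [interior_Icc, mem_Ioo] at ht
    rw [(hd t).deriv]
    have := mul_sinh_le_mul_sinh ht.1.le ht.2.le
    have h2 : x * (2 * t * k) = t * Real.sinh x := by rw [← hkx]; ring
    have h3 : x * Real.sinh t ≤ x * (2 * t * k) := by linarith
    linarith [le_of_mul_le_mul_left h3 hx]

/-- The lower bound is affine in `r²`, so integrating it over the radius needs only the second
moment. -/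
lemma cosh_mul_tangent_le {a r : ℝ} (ha : 0 < a) (hr : 0 ≤ r) (y : ℝ) :
    Real.cosh (a * y) + (r ^ 2 - a ^ 2) * (y * Real.sinh (a * y) / (2 * a)) ≤
      Real.cosh (r * y) := by
  wlog hy : 0 ≤ y generalizing y
  · have := this (-y) (by linarith)
    simpa using this
  rcases hy.eq_or_lt with rfl | hy
  · simp
  have := cosh_tangent_le (mul_pos ha hy) (mul_nonneg hr hy.le)
  convert this using 2
  field_simp

lemma integral_volumeIoiPow (n : ℕ) (f : ℝ → ℝ) :
    ∫ r : Ioi (0 : ℝ), f r ∂Measure.volumeIoiPow n = ∫ y in Ioi (0 : ℝ), y ^ n * f y := by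
  simp only [Measure.volumeIoiPow, ENNReal.ofReal]
  rw [integral_withDensity_eq_integral_smul,
    integral_subtype_comap measurableSet_Ioi fun a ↦ Real.toNNReal (a ^ n) • f a,
    setIntegral_congr_fun measurableSet_Ioi fun x hx ↦ ?_]
  · rw [NNReal.smul_def, Real.coe_toNNReal _ (pow_nonneg hx.out.le _), smul_eq_mul]
  · exact (measurable_subtype_coe.pow_const _).real_toNNReal

lemma integrable_volumeIoiPow_iff (n : ℕ) (f : ℝ → ℝ) :
    Integrable (fun r : Ioi (0 : ℝ) => f r) (Measure.volumeIoiPow n) ↔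
      IntegrableOn (fun y : ℝ => y ^ n * f y) (Ioi 0) := by
  rw [integrableOn_iff_comap_subtypeVal measurableSet_Ioi, Function.comp_def,
    Measure.volumeIoiPow, integrable_withDensity_iff_integrable_smul', integrable_congr]
  · refine .of_forall ?_
    rintro ⟨x, hx : 0 < x⟩
    simp (disch := positivity) [ENNReal.toReal_ofReal]
  · fun_prop
  · simp

lemma integrable_pow_mul_gaussian_volumeIoiPow (n m : ℕ) :
    Integrable (fun r : Ioi (0 : ℝ) => (r : ℝ) ^ m * Real.exp (-(r : ℝ) ^ 2 / 2))
      (Measure.volumeIoiPow n) := by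
  rw [integrable_volumeIoiPow_iff n (fun y => y ^ m * Real.exp (-y ^ 2 / 2))]
  have h := integrableOn_rpow_mul_exp_neg_mul_sq (b := 1 / 2) (by norm_num)
    (s := ((n + m : ℕ) : ℝ)) (by have := Nat.cast_nonneg (α := ℝ) (n + m); linarith)
  refine h.congr_fun (fun y _ => ?_) measurableSet_Ioi
  simp only [Real.rpow_natCast]
  rw [pow_add, mul_assoc]
  ring_nf

lemma integral_pow_mul_gaussian_volumeIoiPow (n m : ℕ) :
    ∫ r : Ioi (0 : ℝ), (r : ℝ) ^ m * Real.exp (-(r : ℝ) ^ 2 / 2) ∂Measure.volumeIoiPow n =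
      (1 / 2 : ℝ) ^ (-((n + m : ℕ) + 1 : ℝ) / 2) * (1 / 2) *
        Real.Gamma (((n + m : ℕ) + 1 : ℝ) / 2) := by
  rw [integral_volumeIoiPow n (fun y => y ^ m * Real.exp (-y ^ 2 / 2))]
  have h := integral_rpow_mul_exp_neg_mul_rpow (p := 2) (q := ((n + m : ℕ) : ℝ)) (b := 1 / 2)
    (by norm_num) (by have := Nat.cast_nonneg (α := ℝ) (n + m); linarith) (by norm_num)
  rw [← h]
  refine setIntegral_congr_fun measurableSet_Ioi (fun y _ => ?_)
  simp only [Real.rpow_natCast, Real.rpow_two]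
  rw [pow_add, mul_assoc]
  ring_nf

/-- Follows from `Γ(s + 1) = s Γ(s)`; in dimension `n + 1` it is the identity `E r² = n + 1`. -/
lemma integral_sq_mul_gaussian_volumeIoiPow (n : ℕ) :
    ∫ r : Ioi (0 : ℝ), (r : ℝ) ^ 2 * Real.exp (-(r : ℝ) ^ 2 / 2) ∂Measure.volumeIoiPow n =
      (n + 1) * ∫ r : Ioi (0 : ℝ), Real.exp (-(r : ℝ) ^ 2 / 2) ∂Measure.volumeIoiPow n := by
  have h0 := integral_pow_mul_gaussian_volumeIoiPow n 0
  simp only [pow_zero, one_mul] at h0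
  rw [integral_pow_mul_gaussian_volumeIoiPow, h0]
  have hn : (0 : ℝ) < ((n : ℝ) + 1) / 2 := by positivity
  have h1 : (((n + 2 : ℕ) : ℝ) + 1) / 2 = ((n : ℝ) + 1) / 2 + 1 := by push_cast; ring
  have h2 : -(((n + 2 : ℕ) : ℝ) + 1) / 2 = -((n : ℝ) + 1) / 2 + (-1) := by push_cast; ring
  rw [h1, h2, Real.Gamma_add_one hn.ne', Real.rpow_add (by norm_num), Real.rpow_neg_one]
  simp only [add_zero]
  ring

lemma integral_gaussian_volumeIoiPow_pos (n : ℕ) :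
    0 < ∫ r : Ioi (0 : ℝ), Real.exp (-(r : ℝ) ^ 2 / 2) ∂Measure.volumeIoiPow n := by
  have h0 := integral_pow_mul_gaussian_volumeIoiPow n 0
  simp only [pow_zero, one_mul] at h0
  rw [h0]
  have : 0 < Real.Gamma (((n + 0 : ℕ) + 1 : ℝ) / 2) := Real.Gamma_pos_of_pos (by positivity)
  positivity

/-- Jensen's inequality for `s ↦ cosh (√s y)` and the squared radius of a Gaussian vector. -/
lemma cosh_mul_le_lintegral_gaussian_cosh (n : ℕ) (y : ℝ) :
    ENNReal.ofReal (Real.cosh (√((n : ℝ) + 1) * y)) *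
        ∫⁻ r : Ioi (0 : ℝ), ENNReal.ofReal (Real.exp (-(r : ℝ) ^ 2 / 2))
          ∂Measure.volumeIoiPow n ≤
      ∫⁻ r : Ioi (0 : ℝ), ENNReal.ofReal (Real.exp (-(r : ℝ) ^ 2 / 2) * Real.cosh (r * y))
        ∂Measure.volumeIoiPow n := by
  set a := √((n : ℝ) + 1) with ha
  have hapos : 0 < a := Real.sqrt_pos.2 (by positivity)
  have hasq : a ^ 2 = n + 1 := Real.sq_sqrt (by positivity)
  set k := y * Real.sinh (a * y) / (2 * a) with hk
  have hi0 : Integrable (fun r : Ioi (0 : ℝ) => Real.exp (-(r : ℝ) ^ 2 / 2))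
      (Measure.volumeIoiPow n) := by
    simpa using integrable_pow_mul_gaussian_volumeIoiPow n 0
  have hi2 := integrable_pow_mul_gaussian_volumeIoiPow n 2
  let f : Ioi (0 : ℝ) → ℝ := fun r =>
    (Real.cosh (a * y) - a ^ 2 * k) * Real.exp (-(r : ℝ) ^ 2 / 2) +
      k * ((r : ℝ) ^ 2 * Real.exp (-(r : ℝ) ^ 2 / 2))
  have hfi : Integrable f (Measure.volumeIoiPow n) := (hi0.const_mul _).add (hi2.const_mul _)
  have hf : ∫ r, f r ∂Measure.volumeIoiPow n = Real.cosh (a * y) *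
      ∫ r : Ioi (0 : ℝ), Real.exp (-(r : ℝ) ^ 2 / 2) ∂Measure.volumeIoiPow n := by
    rw [integral_add (hi0.const_mul _) (hi2.const_mul _), integral_const_mul,
      integral_const_mul, integral_sq_mul_gaussian_volumeIoiPow, hasq]
    ring
  rw [← ofReal_integral_eq_lintegral_ofReal hi0 (.of_forall fun r => (Real.exp_pos _).le),
    ← ENNReal.ofReal_mul (Real.cosh_pos _).le, ← hf]
  -- The tangent function `f` may be negative; passing to its positive part allows comparison of
  -- lower integrals without integrability of the `cosh` integrand.
  calc ENNReal.ofReal (∫ r, f r ∂Measure.volumeIoiPow n)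
      ≤ ENNReal.ofReal (∫ r, max (f r) 0 ∂Measure.volumeIoiPow n) :=
        ENNReal.ofReal_le_ofReal (integral_mono hfi hfi.pos_part fun r => le_max_left _ _)
    _ = ∫⁻ r, ENNReal.ofReal (max (f r) 0) ∂Measure.volumeIoiPow n :=
        ofReal_integral_eq_lintegral_ofReal hfi.pos_part (.of_forall fun r => le_max_right _ _)
    _ ≤ _ := by
        refine lintegral_mono fun r => ENNReal.ofReal_le_ofReal (max_le ?_ ?_)
        · have := cosh_mul_tangent_le hapos (le_of_lt r.2) y
          rw [← hk] at this
          calc f r = Real.exp (-(r : ℝ) ^ 2 / 2) *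
              (Real.cosh (a * y) + ((r : ℝ) ^ 2 - a ^ 2) * k) := by simp only [f]; ring
            _ ≤ _ := by gcongr
        · exact mul_nonneg (Real.exp_pos _).le (Real.cosh_pos _).le

variable {E : Type*} [NormedAddCommGroup E] [InnerProductSpace ℝ E] [FiniteDimensional ℝ E]
  [MeasurableSpace E] [BorelSpace E] (μ : Measure E) [μ.IsAddHaarMeasure]

lemma lintegral_polar [Nontrivial E] {h : E → ENNReal} (hh : Measurable h) :
    ∫⁻ x, h x ∂μ = ∫⁻ u : Metric.sphere (0 : E) 1, ∫⁻ r : Ioi (0 : ℝ), h ((r : ℝ) • (u : E))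
      ∂Measure.volumeIoiPow (finrank ℝ E - 1) ∂μ.toSphere := by
  have hm : Measurable fun p : Metric.sphere (0 : E) 1 × Ioi (0 : ℝ) =>
      h ((p.2 : ℝ) • (p.1 : E)) := by fun_prop
  rw [lintegral_lintegral hm.aemeasurable,
    ← μ.measurePreserving_homeomorphUnitSphereProd.lintegral_comp hm]
  trans ∫⁻ x : ({0}ᶜ : Set E), h x ∂μ.comap Subtype.val
  · rw [lintegral_subtype_comap (measurableSet_singleton _).compl, restrict_compl_singleton]
  refine lintegral_congr fun x => ?_
  have hx : ‖(x : E)‖ ≠ 0 := norm_ne_zero_iff.2 x.2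
  simp [smul_smul, hx]

/-- Antipodal symmetry is inherited from the reflection invariance of `μ`: integrate `f (x / ‖x‖)`
against a Gaussian weight and cancel the finite nonzero radial mass `M`. -/
lemma lintegral_toSphere_neg [Nontrivial E] {f : E → ENNReal} (hf : Measurable f) :
    ∫⁻ u : Metric.sphere (0 : E) 1, f (-(u : E)) ∂μ.toSphere =
      ∫⁻ u : Metric.sphere (0 : E) 1, f (u : E) ∂μ.toSphere := by
  set M := ∫⁻ r : Ioi (0 : ℝ), ENNReal.ofReal (Real.exp (-(r : ℝ) ^ 2 / 2))
    ∂Measure.volumeIoiPow (finrank ℝ E - 1) with hM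
  have hi0 : Integrable (fun r : Ioi (0 : ℝ) => Real.exp (-(r : ℝ) ^ 2 / 2))
      (Measure.volumeIoiPow (finrank ℝ E - 1)) := by
    simpa using integrable_pow_mul_gaussian_volumeIoiPow (finrank ℝ E - 1) 0
  have hMeq : M = ENNReal.ofReal (∫ r : Ioi (0 : ℝ), Real.exp (-(r : ℝ) ^ 2 / 2)
      ∂Measure.volumeIoiPow (finrank ℝ E - 1)) :=
    (ofReal_integral_eq_lintegral_ofReal hi0 (.of_forall fun r => (Real.exp_pos _).le)).symm
  have hM0 : M ≠ 0 := by
    rw [hMeq]; simpa using integral_gaussian_volumeIoiPow_pos (finrank ℝ E - 1)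
  have hMt : M ≠ ⊤ := by rw [hMeq]; simp
  have key : ∀ g : E → ENNReal, Measurable g →
      ∫⁻ x : E, g (‖x‖⁻¹ • x) * ENNReal.ofReal (Real.exp (-‖x‖ ^ 2 / 2)) ∂μ =
        (∫⁻ u : Metric.sphere (0 : E) 1, g (u : E) ∂μ.toSphere) * M := by
    intro g hg
    rw [lintegral_polar μ (by fun_prop), ← lintegral_mul_const _ (by fun_prop)]
    refine lintegral_congr fun u => ?_
    rw [hM, ← lintegral_const_mul _ (by fun_prop)]
    refine lintegral_congr fun r => ?_
    have hr : (0 : ℝ) < r := r.2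
    simp [norm_smul, smul_smul, hr.ne', abs_of_pos hr]
  have h1 := key f hf
  have h2 := key (fun x => f (-x)) (by fun_prop)
  rw [← lintegral_neg_eq_self] at h1
  simp only [norm_neg, smul_neg] at h1
  rw [h1] at h2
  exact ((ENNReal.mul_left_inj hM0 hMt).1 h2).symm

end Sphere

/-! ### Subgaussianity of the sphere and Gaussian linearization -/

section Subgaussian

open Module Set

lemma lintegral_gaussian_volumeIoiPow_ne_zero (n : ℕ) :
    ∫⁻ r : Ioi (0 : ℝ), ENNReal.ofReal (Real.exp (-(r : ℝ) ^ 2 / 2))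
      ∂Measure.volumeIoiPow n ≠ 0 := by
  have hi0 : Integrable (fun r : Ioi (0 : ℝ) => Real.exp (-(r : ℝ) ^ 2 / 2))
      (Measure.volumeIoiPow n) := by
    simpa using integrable_pow_mul_gaussian_volumeIoiPow n 0
  rw [← ofReal_integral_eq_lintegral_ofReal hi0 (.of_forall fun r => (Real.exp_pos _).le)]
  simpa using integral_gaussian_volumeIoiPow_pos n

lemma lintegral_gaussian_volumeIoiPow_ne_top (n : ℕ) :
    ∫⁻ r : Ioi (0 : ℝ), ENNReal.ofReal (Real.exp (-(r : ℝ) ^ 2 / 2))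
      ∂Measure.volumeIoiPow n ≠ ⊤ := by
  have hi0 : Integrable (fun r : Ioi (0 : ℝ) => Real.exp (-(r : ℝ) ^ 2 / 2))
      (Measure.volumeIoiPow n) := by
    simpa using integrable_pow_mul_gaussian_volumeIoiPow n 0
  rw [← ofReal_integral_eq_lintegral_ofReal hi0 (.of_forall fun r => (Real.exp_pos _).le)]
  simp

variable {E : Type*} [NormedAddCommGroup E] [InnerProductSpace ℝ E]
  [MeasurableSpace E] [BorelSpace E] (μ : Measure E) [μ.IsAddHaarMeasure]

/-- Complete the square: translate by `w`. -/
lemma lintegral_gaussian_exp_inner (w : E) :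
    ∫⁻ x, ENNReal.ofReal (Real.exp (-‖x‖ ^ 2 / 2 + inner ℝ w x)) ∂μ =
      ENNReal.ofReal (Real.exp (‖w‖ ^ 2 / 2)) *
        ∫⁻ x, ENNReal.ofReal (Real.exp (-‖x‖ ^ 2 / 2)) ∂μ := by
  rw [← lintegral_const_mul _ (by fun_prop),
    ← lintegral_add_right_eq_self (μ := μ) _ w]
  refine lintegral_congr fun x => ?_
  rw [← ENNReal.ofReal_mul (Real.exp_pos _).le, ← Real.exp_add]
  congr 2
  rw [norm_add_sq_real, inner_add_right, real_inner_self_eq_norm_sq, real_inner_comm]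
  ring

variable [FiniteDimensional ℝ E]

lemma lintegral_gaussian_eq [Nontrivial E] :
    ∫⁻ x, ENNReal.ofReal (Real.exp (-‖x‖ ^ 2 / 2)) ∂μ = μ.toSphere univ *
      ∫⁻ r : Ioi (0 : ℝ), ENNReal.ofReal (Real.exp (-(r : ℝ) ^ 2 / 2))
        ∂Measure.volumeIoiPow (finrank ℝ E - 1) := by
  rw [lintegral_polar μ (by fun_prop), mul_comm, ← lintegral_const]
  refine lintegral_congr fun u => lintegral_congr fun r => ?_
  have hr : (0 : ℝ) < r := r.2
  simp [norm_smul, abs_of_pos hr]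

lemma lintegral_gaussian_ne_zero [Nontrivial E] :
    ∫⁻ x, ENNReal.ofReal (Real.exp (-‖x‖ ^ 2 / 2)) ∂μ ≠ 0 := by
  rw [lintegral_gaussian_eq]
  refine mul_ne_zero ?_ (lintegral_gaussian_volumeIoiPow_ne_zero _)
  rw [Ne, Measure.measure_univ_eq_zero]
  exact μ.toSphere_ne_zero

lemma lintegral_gaussian_ne_top [Nontrivial E] :
    ∫⁻ x, ENNReal.ofReal (Real.exp (-‖x‖ ^ 2 / 2)) ∂μ ≠ ⊤ := by
  rw [lintegral_gaussian_eq]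
  exact ENNReal.mul_ne_top (measure_ne_top _ _) (lintegral_gaussian_volumeIoiPow_ne_top _)

lemma lintegral_gaussian_cosh_inner (w : E) :
    ∫⁻ x, ENNReal.ofReal (Real.exp (-‖x‖ ^ 2 / 2) * Real.cosh (inner ℝ w x)) ∂μ =
      ENNReal.ofReal (Real.exp (‖w‖ ^ 2 / 2)) *
        ∫⁻ x, ENNReal.ofReal (Real.exp (-‖x‖ ^ 2 / 2)) ∂μ := by
  have h2 : (2 : ENNReal) ≠ 0 := by norm_num
  rw [← ENNReal.mul_right_inj h2 ENNReal.ofNat_ne_top, ← lintegral_const_mul _ (by fun_prop),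
    two_mul (ENNReal.ofReal _ * _)]
  nth_rw 1 [← lintegral_gaussian_exp_inner μ w]
  rw [← norm_neg w, ← lintegral_gaussian_exp_inner μ (-w), ← lintegral_add_left (by fun_prop)]
  refine lintegral_congr fun x => ?_
  rw [← ENNReal.ofReal_add (Real.exp_pos _).le (Real.exp_pos _).le, ← ENNReal.ofReal_ofNat 2,
    ← ENNReal.ofReal_mul (by norm_num), Real.cosh_eq, Real.exp_add, Real.exp_add, inner_neg_left]
  congr 1
  ring

lemma lintegral_gaussian_mul_sq {b : ℝ} (hb : 0 < b) :
    ∫⁻ x, ENNReal.ofReal (Real.exp (-(b * ‖x‖ ^ 2) / 2)) ∂μ =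
      ENNReal.ofReal (b ^ (-(finrank ℝ E : ℝ) / 2)) *
        ∫⁻ x, ENNReal.ofReal (Real.exp (-‖x‖ ^ 2 / 2)) ∂μ := by
  have hs : 0 < √b := Real.sqrt_pos.2 hb
  have h := Measure.map_addHaar_smul μ hs.ne'
  have h1 : ∫⁻ x, ENNReal.ofReal (Real.exp (-‖x‖ ^ 2 / 2)) ∂(Measure.map (√b • ·) μ) =
      ∫⁻ x, ENNReal.ofReal (Real.exp (-(b * ‖x‖ ^ 2) / 2)) ∂μ := by
    rw [lintegral_map (by fun_prop) (by fun_prop)]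
    refine lintegral_congr fun x => ?_
    rw [norm_smul, mul_pow, Real.norm_eq_abs, sq_abs, Real.sq_sqrt hb.le]
  rw [← h1, h, lintegral_smul_measure, smul_eq_mul, abs_of_pos (by positivity)]
  congr 2
  rw [Real.sqrt_eq_rpow, ← Real.rpow_natCast, ← Real.rpow_mul hb.le, ← Real.rpow_neg hb.le]
  congr 1
  ring

/-- Antipodal symmetry replaces `exp` by its even part, to which the Jensen step applies. -/
lemma lintegral_toSphere_exp_eq_cosh [Nontrivial E] (w : E) :
    ∫⁻ u : Metric.sphere (0 : E) 1, ENNReal.ofReal (Real.exp (inner ℝ w (u : E)))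
        ∂μ.toSphere =
      ∫⁻ u : Metric.sphere (0 : E) 1, ENNReal.ofReal (Real.cosh (inner ℝ w (u : E)))
        ∂μ.toSphere := by
  have h2 : (2 : ENNReal) ≠ 0 := by norm_num
  have h := lintegral_toSphere_neg μ
    (f := fun x => ENNReal.ofReal (Real.exp (inner ℝ w x))) (by fun_prop)
  rw [← ENNReal.mul_right_inj h2 ENNReal.ofNat_ne_top,
    ← lintegral_const_mul _ (by fun_prop), ← lintegral_const_mul _ (by fun_prop)]
  simp only [two_mul]
  rw [lintegral_add_left (by fun_prop)]
  nth_rw 2 [← h]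
  rw [← lintegral_add_left (by fun_prop)]
  refine lintegral_congr fun u => ?_
  rw [← ENNReal.ofReal_add (Real.exp_pos _).le (Real.exp_pos _).le,
    ← ENNReal.ofReal_add (Real.cosh_pos _).le (Real.cosh_pos _).le, Real.cosh_eq, inner_neg_right]
  congr 1
  ring

/-- After multiplication by the radial Gaussian mass, Jensen applies on each ray, and polar
coordinates reassemble a Gaussian integral known exactly. -/
lemma lintegral_toSphere_cosh_le [Nontrivial E] (w : E) :
    ∫⁻ u : Metric.sphere (0 : E) 1,
        ENNReal.ofReal (Real.cosh (√(finrank ℝ E : ℝ) * inner ℝ w (u : E))) ∂μ.toSphere ≤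
      ENNReal.ofReal (Real.exp (‖w‖ ^ 2 / 2)) * μ.toSphere univ := by
  have hM0 := lintegral_gaussian_volumeIoiPow_ne_zero (finrank ℝ E - 1)
  have hMt := lintegral_gaussian_volumeIoiPow_ne_top (finrank ℝ E - 1)
  have hd : ((finrank ℝ E - 1 : ℕ) : ℝ) + 1 = finrank ℝ E := by
    have : 0 < finrank ℝ E := finrank_pos
    exact_mod_cast Nat.sub_add_cancel this
  rw [← ENNReal.mul_le_mul_iff_left hM0 hMt, mul_assoc, ← lintegral_gaussian_eq,
    ← lintegral_gaussian_cosh_inner, lintegral_polar μ (by fun_prop),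
    ← lintegral_mul_const _ (by fun_prop)]
  refine lintegral_mono fun u => ?_
  have h := cosh_mul_le_lintegral_gaussian_cosh (finrank ℝ E - 1) (inner ℝ w (u : E))
  rw [hd] at h
  refine h.trans_eq (lintegral_congr fun r => ?_)
  have hr : (0 : ℝ) < r := r.2
  simp [norm_smul, abs_of_pos hr, inner_smul_right]

/-- A uniformly distributed point on the unit sphere of a `d`-dimensional space is subgaussian with
variance proxy `1 / d`. -/
theorem lintegral_exp_inner_uniformSphere_le [Nontrivial E] (w : E) :
    ∫⁻ x, ENNReal.ofReal (Real.exp (inner ℝ w x)) ∂uniformSphere E ≤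
      ENNReal.ofReal (Real.exp (‖w‖ ^ 2 / (2 * finrank ℝ E))) := by
  have hC0 : (Measure.addHaar : Measure E).toSphere univ ≠ 0 := by
    rw [Ne, Measure.measure_univ_eq_zero]
    exact Measure.toSphere_ne_zero _
  have hCt : (Measure.addHaar : Measure E).toSphere univ ≠ ⊤ := measure_ne_top _ _
  have hd : (0 : ℝ) < finrank ℝ E := by exact_mod_cast finrank_pos (R := ℝ) (M := E)
  have hsd : 0 < √(finrank ℝ E : ℝ) := Real.sqrt_pos.2 hd
  rw [uniformSphere, lintegral_map (by fun_prop) measurable_subtype_coe, lintegral_smul_measure,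
    smul_eq_mul, ENNReal.inv_mul_le_iff hC0 hCt, lintegral_toSphere_exp_eq_cosh, mul_comm]
  have h := lintegral_toSphere_cosh_le Measure.addHaar ((√(finrank ℝ E : ℝ))⁻¹ • w)
  simp only [inner_smul_left, norm_smul, mul_pow, conj_trivial, norm_inv, Real.norm_eq_abs,
    inv_pow, sq_abs, Real.sq_sqrt hd.le, mul_inv_cancel_left₀ hsd.ne'] at h
  refine h.trans_eq ?_
  congr 3
  field_simp

/-- The moment generating function of the squared norm of a sum of independent, linearly
transformed, uniformly distributed points of the unit sphere. -/
theorem lintegral_exp_sq_norm_sum_le [Nontrivial E] {Ω ι : Type*} [MeasurableSpace Ω]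
    [Fintype ι] {P : Measure Ω} [IsProbabilityMeasure P] {X : ι → Ω → E}
    (hX : ∀ i, Measurable (X i)) (hind : iIndepFun X P)
    (hlaw : ∀ i, P.map (X i) = uniformSphere E) (T T' : ι → E → E) (hT : ∀ i, Measurable (T i))
    (hadj : ∀ i g x, inner ℝ g (T i x) = inner ℝ (T' i g) x) (c : ι → ℝ)
    (hc : ∀ i g, ‖T' i g‖ ^ 2 ≤ c i * ‖g‖ ^ 2) (hc1 : ∑ i, c i ≤ 1)
    {t : ℝ} (ht : 0 ≤ t)
    (htd : 2 * t < finrank ℝ E) :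
    ∫⁻ ω, ENNReal.ofReal (Real.exp (t * ‖∑ i, T i (X i ω)‖ ^ 2)) ∂P ≤
      ENNReal.ofReal ((1 - 2 * t / finrank ℝ E) ^ (-(finrank ℝ E : ℝ) / 2)) := by
  have hd : (0 : ℝ) < finrank ℝ E := by exact_mod_cast finrank_pos (R := ℝ) (M := E)
  let ν : Measure E := Measure.addHaar
  have hM0 := lintegral_gaussian_ne_zero ν
  have hMt := lintegral_gaussian_ne_top ν
  have hb : 0 < 1 - 2 * t / finrank ℝ E := by
    rw [sub_pos, div_lt_one hd]; exact htd
  -- Chosen so that the Gaussian average of `exp ⟨s Z, g⟩` is `exp (s² ‖Z‖² / 2) = exp (t ‖Z‖²)`.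
  set s := √(2 * t) with hs
  have hs2 : s ^ 2 = 2 * t := Real.sq_sqrt (by positivity)
  have hZ : Measurable fun ω => ∑ i, T i (X i ω) :=
    Finset.measurable_sum _ fun i _ => (hT i).comp (hX i)
  rw [← ENNReal.mul_le_mul_iff_left hM0 hMt, ← lintegral_gaussian_mul_sq ν hb,
    ← lintegral_mul_const _ (by fun_prop)]
  calc ∫⁻ ω, ENNReal.ofReal (Real.exp (t * ‖∑ i, T i (X i ω)‖ ^ 2)) *
        ∫⁻ x, ENNReal.ofReal (Real.exp (-‖x‖ ^ 2 / 2)) ∂ν ∂P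
      = ∫⁻ ω, ∫⁻ g, ENNReal.ofReal
          (Real.exp (-‖g‖ ^ 2 / 2 + inner ℝ (s • ∑ i, T i (X i ω)) g)) ∂ν ∂P := by
        refine lintegral_congr fun ω => ?_
        rw [lintegral_gaussian_exp_inner, norm_smul, mul_pow, Real.norm_eq_abs, sq_abs, hs2]
        congr 3
        ring
    _ = ∫⁻ g, ∫⁻ ω, ENNReal.ofReal
          (Real.exp (-‖g‖ ^ 2 / 2 + inner ℝ (s • ∑ i, T i (X i ω)) g)) ∂P ∂ν := by
        refine lintegral_lintegral_swap (Measurable.aemeasurable ?_)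
        have : Measurable fun p : Ω × E => ∑ i, T i (X i p.1) := hZ.comp measurable_fst
        unfold Function.uncurry
        fun_prop
    _ ≤ ∫⁻ g, ENNReal.ofReal (Real.exp (-((1 - 2 * t / finrank ℝ E) * ‖g‖ ^ 2) / 2)) ∂ν := by
        refine lintegral_mono fun g => ?_
        calc ∫⁻ ω, ENNReal.ofReal
              (Real.exp (-‖g‖ ^ 2 / 2 + inner ℝ (s • ∑ i, T i (X i ω)) g)) ∂P
            = ∫⁻ ω, ENNReal.ofReal (Real.exp (-‖g‖ ^ 2 / 2)) *
                ∏ i, ENNReal.ofReal (Real.exp (inner ℝ (T' i (s • g)) (X i ω))) ∂P := by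
              refine lintegral_congr fun ω => ?_
              rw [← ENNReal.ofReal_prod_of_nonneg fun i _ => (Real.exp_pos _).le,
                ← ENNReal.ofReal_mul (Real.exp_pos _).le, ← Real.exp_sum, ← Real.exp_add]
              congr 3
              rw [inner_smul_left, real_inner_comm, inner_sum, Finset.mul_sum]
              refine Finset.sum_congr rfl fun i _ => ?_
              rw [← hadj, inner_smul_left]
          _ = ENNReal.ofReal (Real.exp (-‖g‖ ^ 2 / 2)) *
                ∏ i, ∫⁻ ω, ENNReal.ofReal (Real.exp (inner ℝ (T' i (s • g)) (X i ω))) ∂P := by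
              have hm : ∀ i, Measurable fun x : E =>
                  ENNReal.ofReal (Real.exp (inner ℝ (T' i (s • g)) x)) := fun i => by fun_prop
              have hm' : ∀ i, Measurable fun ω =>
                  ENNReal.ofReal (Real.exp (inner ℝ (T' i (s • g)) (X i ω))) :=
                fun i => (hm i).comp (hX i)
              rw [lintegral_const_mul _ (Finset.measurable_prod _ fun i _ => hm' i),
                lintegral_prod_eq_prod_lintegral_of_indepFun Finset.univ
                  (fun i ω => ENNReal.ofReal (Real.exp (inner ℝ (T' i (s • g)) (X i ω))))
                  (hind.comp _ hm) hm']
          _ ≤ ENNReal.ofReal (Real.exp (-‖g‖ ^ 2 / 2)) *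
                ∏ i, ENNReal.ofReal (Real.exp (‖T' i (s • g)‖ ^ 2 / (2 * finrank ℝ E))) := by
              gcongr with i
              refine le_trans (le_of_eq ?_) (lintegral_exp_inner_uniformSphere_le (T' i (s • g)))
              rw [← hlaw i, lintegral_map (by fun_prop) (hX i)]
          _ ≤ _ := by
              rw [← ENNReal.ofReal_prod_of_nonneg fun i _ => (Real.exp_pos _).le,
                ← ENNReal.ofReal_mul (Real.exp_pos _).le, ← Real.exp_sum, ← Real.exp_add]
              refine ENNReal.ofReal_le_ofReal (Real.exp_le_exp.2 ?_)
              -- The factors contribute at most `t ‖g‖² / d` to the exponent, leaving a Gaussian of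
              -- inverse variance `1 - 2t/d`.
              have h1 : ∑ i, ‖T' i (s • g)‖ ^ 2 / (2 * finrank ℝ E) ≤
                  ∑ i, c i * (2 * t * ‖g‖ ^ 2 / (2 * finrank ℝ E)) := by
                refine Finset.sum_le_sum fun i _ => ?_
                rw [← mul_div_assoc]
                have h := hc i (s • g)
                rw [norm_smul, mul_pow, Real.norm_eq_abs, sq_abs, hs2] at h
                gcongr
              rw [← Finset.sum_mul] at h1
              have h2 : (∑ i, c i) * (2 * t * ‖g‖ ^ 2 / (2 * finrank ℝ E)) ≤
                  1 * (2 * t * ‖g‖ ^ 2 / (2 * finrank ℝ E)) := by gcongr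
              calc _ ≤ -‖g‖ ^ 2 / 2 + 1 * (2 * t * ‖g‖ ^ 2 / (2 * finrank ℝ E)) := by linarith
                _ = _ := by field_simp; ring

end Subgaussian

/-! ### Chernoff bound -/

section Tail

open Module Set

variable {E : Type*} [NormedAddCommGroup E] [InnerProductSpace ℝ E] [FiniteDimensional ℝ E]
  [MeasurableSpace E] [BorelSpace E] {Ω ι : Type*} [MeasurableSpace Ω] [Fintype ι]
  {P : Measure Ω} [IsProbabilityMeasure P]

/-- Measurable versions of the `X i` keep their laws and independence. The adjoint pairs `T`, `T'`
cover both real scalars and complex scalars acting on `ℂ^L` as a real space. -/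
theorem lintegral_exp_sq_norm_sum_le_of_hasLaw [Nontrivial E] {X : ι → Ω → E}
    (hind : iIndepFun X P) (hlaw : ∀ i, HasLaw (X i) (uniformSphere E) P)
    (T T' : ι → E → E) (hT : ∀ i, Measurable (T i))
    (hadj : ∀ i g x, inner ℝ g (T i x) = inner ℝ (T' i g) x) (c : ι → ℝ)
    (hc : ∀ i g, ‖T' i g‖ ^ 2 ≤ c i * ‖g‖ ^ 2) (hc1 : ∑ i, c i ≤ 1) {t : ℝ} (ht : 0 ≤ t)
    (htd : 2 * t < finrank ℝ E) :
    ∫⁻ ω, ENNReal.ofReal (Real.exp (t * ‖∑ i, T i (X i ω)‖ ^ 2)) ∂P ≤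
      ENNReal.ofReal ((1 - 2 * t / finrank ℝ E) ^ (-(finrank ℝ E : ℝ) / 2)) := by
  have hX := fun i => (hlaw i).aemeasurable
  have h := lintegral_exp_sq_norm_sum_le (X := fun i => (hX i).mk)
    (fun i => (hX i).measurable_mk) (hind.congr fun i => (hX i).ae_eq_mk)
    (fun i => (Measure.map_congr (hX i).ae_eq_mk).symm.trans (hlaw i).map_eq)
    T T' hT hadj c hc hc1 ht htd
  refine le_trans (le_of_eq (lintegral_congr_ae ?_)) h
  have hae : ∀ᵐ ω ∂P, ∀ i, X i ω = (hX i).mk _ ω := ae_all_iff.2 fun i => (hX i).ae_eq_mk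
  filter_upwards [hae] with ω hω
  simp only [hω]

omit [IsProbabilityMeasure P] in
/-- The Chernoff bound for a variable whose moment generating function is dominated by that of a
normalized chi-square variable. -/
lemma meas_ge_le_of_mgf_le {W : Ω → ℝ} (hW : AEMeasurable W P) {d θ : ℝ} (hd : 0 < d)
    (hθ : 0 < θ) (hθ1 : θ < 1)
    (hmgf : ∀ t, 0 ≤ t → 2 * t < d → ∫⁻ ω, ENNReal.ofReal (Real.exp (t * W ω)) ∂P ≤
      ENNReal.ofReal ((1 - 2 * t / d) ^ (-d / 2))) :
    P {ω | (θ ^ 2)⁻¹ ≤ W ω} ≤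
      ENNReal.ofReal (Real.exp (-(d / 2 * ((θ ^ 2)⁻¹ - Real.log (θ ^ 2)⁻¹ - 1)))) := by
  have hθ2 : 0 < θ ^ 2 := by positivity
  have hθ21 : θ ^ 2 < 1 := by nlinarith
  -- The minimizer of the Chernoff exponent at level `θ⁻²`, where `1 - 2t/d = θ²`.
  set t := d / 2 * (1 - θ ^ 2) with ht
  have ht0 : 0 ≤ t := mul_nonneg (by positivity) (by linarith)
  have htd : 2 * t < d := by rw [ht]; nlinarith [mul_pos hd hθ2]
  have h1t : 1 - 2 * t / d = θ ^ 2 := by rw [ht]; field_simp; ring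
  have hb := hmgf t ht0 htd
  rw [h1t] at hb
  have hm := meas_ge_le_lintegral_div (μ := P)
    (f := fun ω => ENNReal.ofReal (Real.exp (t * W ω))) (by fun_prop)
    (ε := ENNReal.ofReal (Real.exp (t * (θ ^ 2)⁻¹))) (by simpa using Real.exp_pos _) (by simp)
  calc P {ω | (θ ^ 2)⁻¹ ≤ W ω}
      ≤ P {ω | ENNReal.ofReal (Real.exp (t * (θ ^ 2)⁻¹)) ≤
          ENNReal.ofReal (Real.exp (t * W ω))} := by
        refine measure_mono fun ω hω => ENNReal.ofReal_le_ofReal (Real.exp_le_exp.2 ?_)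
        exact mul_le_mul_of_nonneg_left hω ht0
    _ ≤ _ := hm
    _ ≤ ENNReal.ofReal ((θ ^ 2) ^ (-d / 2)) / ENNReal.ofReal (Real.exp (t * (θ ^ 2)⁻¹)) := by
        gcongr
    _ = _ := by
        rw [← ENNReal.ofReal_div_of_pos (Real.exp_pos _), Real.rpow_def_of_pos hθ2,
          ← Real.exp_sub, Real.log_inv]
        congr 2
        rw [ht]
        field_simp
        ring

end Tail

/-! ### Tails of row combinations in the two models -/

section Models

open Module Set

variable {Ω ι : Type*} [MeasurableSpace Ω] [Fintype ι] {P : Measure Ω} [IsProbabilityMeasure P]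
  {L : ℕ}

lemma inner_real_complex_smul (z : ℂ) (x y : EuclideanSpace ℂ (Fin L)) :
    inner ℝ x (z • y) = inner ℝ (star z • x) y := by
  simp only [PiLp.inner_apply, PiLp.smul_apply, smul_eq_mul]
  refine Finset.sum_congr rfl fun i _ => ?_
  simp only [Complex.inner, Complex.mul_re, Complex.mul_im, Complex.star_def, Complex.conj_re,
    Complex.conj_im, map_mul]
  ring

/-- The Euclidean norm of the combination of the rows of `M` with coefficients `c`. -/
def combNorm {ι : Type*} [Fintype ι] {L : ℕ} (c : ι → ℂ) (M : Matrix ι (Fin L) ℂ) : ℝ :=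
  ‖(WithLp.toLp 2 (c ᵥ* M) : EuclideanSpace ℂ (Fin L))‖

lemma toLp_vecMul (c : ι → ℂ) (M : Matrix ι (Fin L) ℂ) :
    (WithLp.toLp 2 (c ᵥ* M) : EuclideanSpace ℂ (Fin L)) =
      ∑ i, c i • (WithLp.toLp 2 (M i) : EuclideanSpace ℂ (Fin L)) := by
  ext l
  simp [vecMul, dotProduct]

lemma combNorm_smul (z : ℂ) (c : ι → ℂ) (M : Matrix ι (Fin L) ℂ) :
    combNorm (z • c) M = ‖z‖ * combNorm c M := by
  rw [combNorm, combNorm, smul_vecMul, WithLp.toLp_smul, norm_smul]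

theorem IsComplexSpherical.meas_combNorm_sq_ge_le (hL : 1 ≤ L) {Φ : Ω → Matrix ι (Fin L) ℂ}
    (hΦ : IsComplexSpherical Φ P) {c : ι → ℂ} (hc : ∑ i, ‖c i‖ ^ 2 ≤ 1) {θ : ℝ} (hθ : 0 < θ)
    (hθ1 : θ < 1) :
    P {ω | (θ ^ 2)⁻¹ ≤ combNorm c (Φ ω) ^ 2} ≤
      ENNReal.ofReal (Real.exp (-(L * ((θ ^ 2)⁻¹ - Real.log (θ ^ 2)⁻¹ - 1)))) := by
  have : Nonempty (Fin L) := ⟨⟨0, hL⟩⟩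
  -- The real dimension `2L` is what turns `L / 2` into `L`.
  have hfr : finrank ℝ (EuclideanSpace ℂ (Fin L)) = 2 * L := by
    rw [← Module.finrank_mul_finrank ℝ ℂ (EuclideanSpace ℂ (Fin L))]
    simp
  have hd : (L : ℝ) = (finrank ℝ (EuclideanSpace ℂ (Fin L)) : ℝ) / 2 := by
    rw [hfr]; push_cast; ring
  have hX := fun i => (hΦ.law i).aemeasurable
  nth_rw 1 [hd]
  refine meas_ge_le_of_mgf_le ?_ (by rw [hfr]; positivity) hθ hθ1 fun t ht htd => ?_
  · simp only [combNorm, toLp_vecMul]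
    fun_prop
  · simp only [combNorm, toLp_vecMul]
    exact lintegral_exp_sq_norm_sum_le_of_hasLaw hΦ.indep hΦ.law (fun i x => c i • x)
      (fun i x => star (c i) • x) (fun i => by fun_prop)
      (fun i g x => inner_real_complex_smul (c i) g x) (fun i => ‖c i‖ ^ 2)
      (fun i g => by rw [norm_smul, mul_pow, norm_star]) hc ht htd

lemma combNorm_ofReal_sq (c : ι → ℂ) (M : Matrix ι (Fin L) ℝ) :
    combNorm c (M.map Complex.ofReal) ^ 2 =
      ‖∑ i, (c i).re • (WithLp.toLp 2 (M i) : EuclideanSpace ℝ (Fin L))‖ ^ 2 +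
        ‖∑ i, (c i).im • (WithLp.toLp 2 (M i) : EuclideanSpace ℝ (Fin L))‖ ^ 2 := by
  rw [combNorm, EuclideanSpace.norm_sq_eq, EuclideanSpace.norm_sq_eq, EuclideanSpace.norm_sq_eq,
    ← Finset.sum_add_distrib]
  refine Finset.sum_congr rfl fun l _ => ?_
  rw [← Complex.normSq_eq_norm_sq, Complex.normSq_apply]
  simp [vecMul, dotProduct, pow_two]

lemma sq_norm_sum_smul_eq {F : Type*} [NormedAddCommGroup F] [NormedSpace ℝ F] (a : ι → ℝ)
    {α : ℝ} (hα : 0 ≤ α) (ha : ∑ i, a i ^ 2 ≤ α) (x : ι → F) :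
    ‖∑ i, a i • x i‖ ^ 2 = α * ‖∑ i, (a i / √α) • x i‖ ^ 2 := by
  rcases hα.eq_or_lt with rfl | hα
  -- Here the quotients by `√0` are `0` by convention, which is harmless since every `a i` vanishes.
  · have h0 : ∀ i, a i = 0 := fun i => by
      have := (Finset.single_le_sum (fun j _ => sq_nonneg (a j)) (Finset.mem_univ i)).trans ha
      exact pow_eq_zero_iff two_ne_zero |>.1 (le_antisymm this (sq_nonneg _))
    simp [h0]
  · have hs : 0 < √α := Real.sqrt_pos.2 hα
    have h : ∑ i, a i • x i = √α • ∑ i, (a i / √α) • x i := by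
      rw [Finset.smul_sum]
      refine Finset.sum_congr rfl fun i _ => ?_
      rw [smul_smul, mul_div_cancel₀ _ hs.ne']
    rw [h, norm_smul, mul_pow, Real.norm_eq_abs, sq_abs, Real.sq_sqrt hα.le]

lemma sum_div_sqrt_sq_le_one (a : ι → ℝ) {α : ℝ} (hα : 0 ≤ α) (ha : ∑ i, a i ^ 2 ≤ α) :
    ∑ i, (a i / √α) ^ 2 ≤ 1 := by
  simp only [div_pow, Real.sq_sqrt hα]
  rw [← Finset.sum_div]
  exact div_le_one_of_le₀ ha hα

/-- Complex coefficients do not act on `ℝ^L`, so real and imaginary parts are separated. The squared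
norm becomes a convex combination of two squared norms with real coefficients, dependent on each
other; convexity of `exp` still gives the same moment bound, with no loss. -/
theorem IsRealSpherical.meas_combNorm_sq_ge_le (hL : 1 ≤ L) {Φ : Ω → Matrix ι (Fin L) ℝ}
    (hΦ : IsRealSpherical Φ P) {c : ι → ℂ} (hc : ∑ i, ‖c i‖ ^ 2 ≤ 1) {θ : ℝ} (hθ : 0 < θ)
    (hθ1 : θ < 1) :
    P {ω | (θ ^ 2)⁻¹ ≤ combNorm c ((Φ ω).map Complex.ofReal) ^ 2} ≤
      ENNReal.ofReal (Real.exp (-(L / 2 * ((θ ^ 2)⁻¹ - Real.log (θ ^ 2)⁻¹ - 1)))) := by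
  have : Nonempty (Fin L) := ⟨⟨0, hL⟩⟩
  have hfr : finrank ℝ (EuclideanSpace ℝ (Fin L)) = L := by simp
  have hX := fun i => (hΦ.law i).aemeasurable
  have hL0 : (0 : ℝ) < L := by exact_mod_cast hL
  have hmgf : ∀ a : ι → ℝ, ∑ i, a i ^ 2 ≤ 1 → ∀ t : ℝ, 0 ≤ t → 2 * t < L →
      ∫⁻ ω, ENNReal.ofReal (Real.exp (t *
        ‖∑ i, a i • (WithLp.toLp 2 (Φ ω i) : EuclideanSpace ℝ (Fin L))‖ ^ 2)) ∂P ≤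
      ENNReal.ofReal ((1 - 2 * t / L) ^ (-(L : ℝ) / 2)) := by
    intro a ha t ht htd
    have h := lintegral_exp_sq_norm_sum_le_of_hasLaw hΦ.indep hΦ.law (fun i x => a i • x)
      (fun i x => a i • x) (fun i => by fun_prop)
      (fun i g x => by rw [inner_smul_left, inner_smul_right]; rfl) (fun i => a i ^ 2)
      (fun i g => by rw [norm_smul, mul_pow, Real.norm_eq_abs, sq_abs]) ha (t := t) ht
      (by rw [hfr]; exact htd)
    rwa [hfr] at h
  set α := ∑ i, (c i).re ^ 2 with hα
  have hα0 : 0 ≤ α := Finset.sum_nonneg fun i _ => sq_nonneg _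
  have hβ : ∑ i, (c i).im ^ 2 ≤ 1 - α := by
    have : ∑ i, ‖c i‖ ^ 2 = α + ∑ i, (c i).im ^ 2 := by
      rw [hα, ← Finset.sum_add_distrib]
      refine Finset.sum_congr rfl fun i _ => ?_
      rw [← Complex.normSq_eq_norm_sq, Complex.normSq_apply]; ring
    linarith
  have hβ0 : 0 ≤ 1 - α := (Finset.sum_nonneg fun i _ => sq_nonneg _).trans hβ
  refine meas_ge_le_of_mgf_le ?_ hL0 hθ hθ1 fun t ht htd => ?_
  · simp only [combNorm_ofReal_sq]
    fun_prop
  set U : Ω → ℝ := fun ω =>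
    ‖∑ i, ((c i).re / √α) • (WithLp.toLp 2 (Φ ω i) : EuclideanSpace ℝ (Fin L))‖ ^ 2
  set V : Ω → ℝ := fun ω =>
    ‖∑ i, ((c i).im / √(1 - α)) • (WithLp.toLp 2 (Φ ω i) : EuclideanSpace ℝ (Fin L))‖ ^ 2
  have hU : AEMeasurable U P := by fun_prop
  have hV : AEMeasurable V P := by fun_prop
  have hconv : ∀ ω, combNorm c ((Φ ω).map Complex.ofReal) ^ 2 = α * U ω + (1 - α) * V ω :=
    fun ω => by
      rw [combNorm_ofReal_sq, sq_norm_sum_smul_eq _ hα0 hα.ge, sq_norm_sum_smul_eq _ hβ0 hβ]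
  calc ∫⁻ ω, ENNReal.ofReal (Real.exp (t * combNorm c ((Φ ω).map Complex.ofReal) ^ 2)) ∂P
      ≤ ∫⁻ ω, (ENNReal.ofReal α * ENNReal.ofReal (Real.exp (t * U ω)) +
          ENNReal.ofReal (1 - α) * ENNReal.ofReal (Real.exp (t * V ω))) ∂P := by
        refine lintegral_mono fun ω => ?_
        rw [← ENNReal.ofReal_mul hα0, ← ENNReal.ofReal_mul hβ0,
          ← ENNReal.ofReal_add (by positivity) (mul_nonneg hβ0 (Real.exp_pos _).le), hconv]
        refine ENNReal.ofReal_le_ofReal ?_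
        have h := convexOn_exp.2 (mem_univ (t * U ω)) (mem_univ (t * V ω)) hα0 hβ0 (by ring)
        simp only [smul_eq_mul] at h
        rwa [show t * (α * U ω + (1 - α) * V ω) = α * (t * U ω) + (1 - α) * (t * V ω) by ring]
    _ = ENNReal.ofReal α * ∫⁻ ω, ENNReal.ofReal (Real.exp (t * U ω)) ∂P +
          ENNReal.ofReal (1 - α) * ∫⁻ ω, ENNReal.ofReal (Real.exp (t * V ω)) ∂P := by
        rw [lintegral_add_left' (by fun_prop), lintegral_const_mul'' _ (by fun_prop),
          lintegral_const_mul'' _ (by fun_prop)]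
    _ ≤ ENNReal.ofReal α * ENNReal.ofReal ((1 - 2 * t / L) ^ (-(L : ℝ) / 2)) +
          ENNReal.ofReal (1 - α) * ENNReal.ofReal ((1 - 2 * t / L) ^ (-(L : ℝ) / 2)) := by
        gcongr
        · exact hmgf _ (sum_div_sqrt_sq_le_one _ hα0 hα.ge) t ht htd
        · exact hmgf _ (sum_div_sqrt_sq_le_one _ hβ0 hβ) t ht htd
    _ = _ := by
        rw [← add_mul, ← ENNReal.ofReal_add hα0 hβ0]
        simp

end Models

/-! ### Deterministic analysis of thresholding and union bound -/

section Recovery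

variable {n N L : ℕ}

lemma mul_extendRows (A : Matrix (Fin n) (Fin N) ℂ) (T : Finset (Fin N))
    (M : Matrix T (Fin L) ℂ) : A * extendRows T M = colsOn A T * M := by
  ext i l
  simp only [Matrix.mul_apply, extendRows, colsOn, Matrix.of_apply, Matrix.submatrix_apply, id]
  rw [← Finset.sum_subset (Finset.subset_univ T) (fun j _ hj => by simp [hj]),
    ← Finset.sum_coe_sort]
  exact Finset.sum_congr rfl fun j _ => by simp

open scoped ComplexOrder in
lemma pinv_mul_mul {m : Type*} [Fintype m] [DecidableEq m] {B : Matrix (Fin n) m ℂ}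
    (hB : LinearIndependent ℂ B.col) (M : Matrix m (Fin L) ℂ) : pinv B * (B * M) = M := by
  have hpos : (Bᴴ * B).PosDef :=
    Matrix.PosDef.conjTranspose_mul_self B (Matrix.mulVec_injective_iff.2 hB)
  rw [pinv, Matrix.mul_assoc, ← Matrix.mul_assoc Bᴴ, ← Matrix.mul_assoc,
    Matrix.nonsing_inv_mul _ ((Matrix.isUnit_iff_isUnit_det _).1 hpos.isUnit), Matrix.one_mul]

/-- If `S` itself is selected, the pseudo-inverse cancels `A_S` and the output is exact. -/
lemma RecoveryFails.supportFails {A : Matrix (Fin n) (Fin N) ℂ} {S : Finset (Fin N)}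
    (hA : LinearIndependent ℂ (fun j : S => A.col j)) {σ : S → ℝ} {M : Matrix S (Fin L) ℂ}
    (h : RecoveryFails A S.card (coeffMatrix S σ M)) : SupportFails A S (coeffMatrix S σ M) := by
  obtain ⟨Z, ⟨T, hT, rfl⟩, hne⟩ := h
  refine ⟨T, hT, ?_⟩
  rintro rfl
  refine hne ?_
  rw [coeffMatrix, mul_extendRows, pinv_mul_mul]
  exact hA

/-- The vector of coefficients of the interference of the atoms of `S` with the `ℓ`-th atom. -/
def interference (A : Matrix (Fin n) (Fin N) ℂ) (S : Finset (Fin N)) (σ : S → ℝ) (ℓ : Fin N) :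
    S → ℂ :=
  fun j => if (j : Fin N) = ℓ then 0 else (star (A.col ℓ) ⬝ᵥ A.col j) * σ j

lemma vecMul_mul_coeffMatrix (A : Matrix (Fin n) (Fin N) ℂ) (S : Finset (Fin N)) (σ : S → ℝ)
    (M : Matrix S (Fin L) ℂ) (ℓ : Fin N) :
    star (A.col ℓ) ᵥ* (A * coeffMatrix S σ M) =
      (fun j : S => (star (A.col ℓ) ⬝ᵥ A.col j) * σ j) ᵥ* M := by
  rw [coeffMatrix, mul_extendRows, ← Matrix.mul_assoc, ← vecMul_vecMul, ← vecMul_vecMul]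
  congr 1
  ext j
  rw [vecMul_diagonal]
  rfl

lemma correlation_of_notMem (A : Matrix (Fin n) (Fin N) ℂ) {S : Finset (Fin N)} (σ : S → ℝ)
    (M : Matrix S (Fin L) ℂ) {ℓ : Fin N} (hℓ : ℓ ∉ S) :
    correlation A (A * coeffMatrix S σ M) ℓ = combNorm (interference A S σ ℓ) M := by
  rw [correlation, vecMul_mul_coeffMatrix, combNorm]
  congr 4
  ext j
  have : (j : Fin N) ≠ ℓ := fun h => hℓ (h ▸ j.2)
  simp [interference, this]

lemma star_dotProduct_self_of_norm {m : Type*} [Fintype m] {v : m → ℂ}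
    (hv : ‖(WithLp.toLp 2 v : EuclideanSpace ℂ m)‖ = 1) : star v ⬝ᵥ v = 1 := by
  have h := inner_self_eq_norm_sq_to_K (𝕜 := ℂ) (WithLp.toLp 2 v : EuclideanSpace ℂ m)
  rw [hv, EuclideanSpace.inner_eq_star_dotProduct] at h
  simpa [dotProduct_comm] using h

/-- Reverse triangle inequality: the diagonal term has norm exactly `σ ℓ`, as atoms and rows are
unit vectors. -/
lemma le_correlation_of_mem {A : Matrix (Fin n) (Fin N) ℂ}
    (hA : ∀ j, ‖(WithLp.toLp 2 (A.col j) : EuclideanSpace ℂ (Fin n))‖ = 1)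
    {S : Finset (Fin N)} {σ : S → ℝ} (hσ : ∀ j, 0 < σ j) {M : Matrix S (Fin L) ℂ}
    (hM : ∀ j, ‖(WithLp.toLp 2 (M j) : EuclideanSpace ℂ (Fin L))‖ = 1) (ℓ : S) :
    σ ℓ - combNorm (interference A S σ ℓ) M ≤ correlation A (A * coeffMatrix S σ M) ℓ := by
  have h : (WithLp.toLp 2 (star (A.col ℓ) ᵥ* (A * coeffMatrix S σ M)) :
      EuclideanSpace ℂ (Fin L)) = (σ ℓ : ℂ) • WithLp.toLp 2 (M ℓ) +
        WithLp.toLp 2 (interference A S σ ℓ ᵥ* M) := by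
    rw [vecMul_mul_coeffMatrix, toLp_vecMul, toLp_vecMul,
      ← Finset.add_sum_erase _ _ (Finset.mem_univ ℓ),
      ← Finset.add_sum_erase _ (fun j => interference A S σ ℓ j • _) (Finset.mem_univ ℓ),
      star_dotProduct_self_of_norm (hA ℓ)]
    simp only [interference, if_true, zero_smul, zero_add, one_mul]
    congr 1
    refine Finset.sum_congr rfl fun j hj => ?_
    have : (j : Fin N) ≠ ℓ := fun h => Finset.ne_of_mem_erase hj (Subtype.ext h)
    rw [if_neg this]
  rw [correlation, h, combNorm, sub_le_iff_le_add]
  calc σ ℓ = ‖(σ ℓ : ℂ) • (WithLp.toLp 2 (M ℓ) : EuclideanSpace ℂ (Fin L))‖ := by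
        rw [norm_smul, hM, mul_one, Complex.norm_real, Real.norm_of_nonneg (hσ ℓ).le]
    _ ≤ _ := by
        have := norm_sub_le ((σ ℓ : ℂ) • (WithLp.toLp 2 (M ℓ) : EuclideanSpace ℂ (Fin L)) +
          WithLp.toLp 2 (interference A S σ ℓ ᵥ* M)) (WithLp.toLp 2 (interference A S σ ℓ ᵥ* M))
        rwa [add_sub_cancel_right] at this

/-- A wrong `T` of the same size contains some `ℓ ∉ S` and misses some `j ∈ S`. Selection forces `σ
j` to be at most the sum of the two interferences, so one of them is at least half of it. Isolating
a single index keeps the union bound at `N` terms rather than one per pair. -/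
lemma SupportFails.exists_interference {A : Matrix (Fin n) (Fin N) ℂ}
    (hA : ∀ j, ‖(WithLp.toLp 2 (A.col j) : EuclideanSpace ℂ (Fin n))‖ = 1)
    {S : Finset (Fin N)} {σ : S → ℝ} (hσ : ∀ j, 0 < σ j) {M : Matrix S (Fin L) ℂ}
    (hM : ∀ j, ‖(WithLp.toLp 2 (M j) : EuclideanSpace ℂ (Fin L))‖ = 1)
    (h : SupportFails A S (coeffMatrix S σ M)) :
    ∃ ℓ : Fin N, (⨅ j, σ j) / 2 ≤ combNorm (interference A S σ ℓ) M := by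
  obtain ⟨T, ⟨hcard, hsel⟩, hne⟩ := h
  obtain ⟨ℓ, hℓT, hℓS⟩ : ∃ ℓ ∈ T, ℓ ∉ S := by
    by_contra! hsub
    exact hne (Finset.eq_of_subset_of_card_le hsub hcard.ge)
  obtain ⟨j, hjS, hjT⟩ : ∃ j ∈ S, j ∉ T := by
    by_contra! hsub
    exact hne (Finset.eq_of_subset_of_card_le hsub hcard.le).symm
  have h1 := hsel ℓ hℓT j hjT
  have h2 := le_correlation_of_mem hA hσ hM ⟨j, hjS⟩
  rw [correlation_of_notMem A σ M hℓS] at h1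
  have h3 : (⨅ j, σ j) ≤ σ ⟨j, hjS⟩ := ciInf_le (Set.finite_range σ).bddBelow _
  by_contra! hcon
  have h4 := hcon ℓ
  have h5 := hcon j
  simp only at h2
  linarith

/-- Erasing a non-member changes nothing, so this form unites both maxima in the coherence. -/
lemma crossNorm_erase_le_localCoherence (A : Matrix (Fin n) (Fin N) ℂ) (S : Finset (Fin N))
    (ℓ : Fin N) : crossNorm A (S.erase ℓ) ℓ ≤ localCoherence A S := by
  by_cases hℓ : ℓ ∈ S
  · exact (le_ciSup (f := fun ℓ : S => crossNorm A (S.erase ℓ) ℓ)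
      (Set.finite_range _).bddAbove ⟨ℓ, hℓ⟩).trans (le_max_right _ _)
  · rw [Finset.erase_eq_of_notMem hℓ]
    exact (le_ciSup (f := fun ℓ : {ℓ : Fin N // ℓ ∉ S} => crossNorm A S ℓ)
      (Set.finite_range _).bddAbove ⟨ℓ, hℓ⟩).trans (le_max_left _ _)

lemma localCoherence_nonneg (A : Matrix (Fin n) (Fin N) ℂ) (S : Finset (Fin N)) :
    0 ≤ localCoherence A S :=
  le_max_of_le_left (Real.iSup_nonneg fun _ => norm_nonneg _)

lemma crossNorm_sq (A : Matrix (Fin n) (Fin N) ℂ) (T : Finset (Fin N)) (ℓ : Fin N) :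
    crossNorm A T ℓ ^ 2 = ∑ j ∈ T, ‖star (A.col ℓ) ⬝ᵥ A.col j‖ ^ 2 := by
  rw [crossNorm, EuclideanSpace.norm_sq_eq,
    ← Finset.sum_coe_sort T (fun j => ‖star (A.col ℓ) ⬝ᵥ A.col j‖ ^ 2)]
  refine Finset.sum_congr rfl fun j _ => ?_
  congr 1
  rw [← norm_star (star (A.col ℓ) ⬝ᵥ A.col j), star_dotProduct, star_star]
  rfl

lemma sum_norm_sq_interference_le (A : Matrix (Fin n) (Fin N) ℂ) {S : Finset (Fin N)}
    {σ : S → ℝ} (hσ : ∀ j, 0 < σ j) (ℓ : Fin N) :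
    ∑ j, ‖interference A S σ ℓ j‖ ^ 2 ≤ ((⨆ j, σ j) * localCoherence A S) ^ 2 := by
  have hsup : ∀ j, σ j ≤ ⨆ j, σ j := fun j => le_ciSup (Set.finite_range σ).bddAbove j
  calc ∑ j, ‖interference A S σ ℓ j‖ ^ 2
      ≤ ∑ j : S, (⨆ j, σ j) ^ 2 *
          (if (j : Fin N) = ℓ then 0 else ‖star (A.col ℓ) ⬝ᵥ A.col j‖ ^ 2) := by
        refine Finset.sum_le_sum fun j _ => ?_
        unfold interference
        split_ifs
        · simp
        · rw [norm_mul, mul_pow, mul_comm, Complex.norm_real, Real.norm_of_nonneg (hσ j).le]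
          gcongr
          · exact (hσ j).le
          · exact hsup j
    _ = (⨆ j, σ j) ^ 2 * crossNorm A (S.erase ℓ) ℓ ^ 2 := by
        rw [← Finset.mul_sum, crossNorm_sq, Finset.sum_coe_sort S (fun j =>
          if j = ℓ then (0 : ℝ) else ‖star (A.col ℓ) ⬝ᵥ A.col j‖ ^ 2), Finset.sum_ite,
          Finset.sum_const_zero, zero_add, Finset.filter_ne']
    _ ≤ _ := by
        rw [mul_pow]
        gcongr
        · exact norm_nonneg _
        · exact crossNorm_erase_le_localCoherence A S ℓ

/-- The union bound over the interferences: it suffices to bound the tails of the norms of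
combinations of the rows with unit coefficient vectors. -/
lemma measureReal_supportFails_le {A : Matrix (Fin n) (Fin N) ℂ}
    (hA : ∀ j, ‖(WithLp.toLp 2 (A.col j) : EuclideanSpace ℂ (Fin n))‖ = 1)
    {S : Finset (Fin N)} (hS : S.Nonempty) {σ : S → ℝ} (hσ : ∀ j, 0 < σ j) {θ : ℝ}
    (hθ : θ = 2 * dynamicRange σ * localCoherence A S) (hθ1 : θ < 1) {Ω : Type*}
    [MeasurableSpace Ω] {P : Measure Ω} {M : Ω → Matrix S (Fin L) ℂ}
    (hM : ∀ᵐ ω ∂P, ∀ j, ‖(WithLp.toLp 2 (M ω j) : EuclideanSpace ℂ (Fin L))‖ = 1) {m : ℝ}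
    (htail : ∀ c : S → ℂ, ∑ j, ‖c j‖ ^ 2 ≤ 1 → 0 < θ → θ < 1 →
      P {ω | (θ ^ 2)⁻¹ ≤ combNorm c (M ω) ^ 2} ≤
        ENNReal.ofReal (Real.exp (-(m * ((θ ^ 2)⁻¹ - Real.log (θ ^ 2)⁻¹ - 1))))) :
    P.real {ω | SupportFails A S (coeffMatrix S σ (M ω))} ≤ failureBound N m θ := by
  have : Nonempty S := hS.to_subtype
  set b := ⨅ j, σ j with hb
  set B := ⨆ j, σ j with hB
  have hbpos : 0 < b := by
    obtain ⟨j, hj⟩ := exists_eq_ciInf_of_finite (f := σ)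
    rw [hb, ← hj]
    exact hσ j
  have hBpos : 0 < B :=
    (hσ (Classical.arbitrary S)).trans_le (le_ciSup (Set.finite_range σ).bddAbove _)
  have hθ0 : 0 ≤ θ := by
    rw [hθ, dynamicRange, ← hb, ← hB]
    have := localCoherence_nonneg A S
    positivity
  have hcoef : ∀ ℓ, ∑ j, ‖interference A S σ ℓ j‖ ^ 2 ≤ (b * θ / 2) ^ 2 := fun ℓ => by
    refine (sum_norm_sq_interference_le A hσ ℓ).trans (le_of_eq ?_)
    rw [← hB, hθ, dynamicRange, ← hb, ← hB]
    field_simp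
  have hsub : P {ω | SupportFails A S (coeffMatrix S σ (M ω))} ≤
      ∑ ℓ : Fin N, P {ω | b / 2 ≤ combNorm (interference A S σ ℓ) (M ω)} := by
    refine (measure_mono_ae ?_).trans (measure_iUnion_fintype_le P
      fun ℓ => {ω | b / 2 ≤ combNorm (interference A S σ ℓ) (M ω)})
    filter_upwards [hM] with ω hω hfail
    exact Set.mem_iUnion.2 (SupportFails.exists_interference hA hσ hω hfail)
  rcases hθ0.eq_or_lt with h0 | hpos
  -- For `θ = 0` all interference vanishes and cannot reach `b / 2 > 0`.
  · have hz : ∀ ℓ, interference A S σ ℓ = 0 := fun ℓ => by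
      ext j
      have h := (Finset.single_le_sum (fun j _ => sq_nonneg ‖interference A S σ ℓ j‖)
        (Finset.mem_univ j)).trans (hcoef ℓ)
      rw [← h0] at h
      have h2 : ‖interference A S σ ℓ j‖ ^ 2 = 0 :=
        le_antisymm (by simpa using h) (sq_nonneg _)
      simpa using h2
    have hempty : ∀ ℓ, {ω | b / 2 ≤ combNorm (interference A S σ ℓ) (M ω)} = ∅ := fun ℓ => by
      ext ω
      simp [hz, combNorm, hbpos]
    simp only [hempty, measure_empty, Finset.sum_const_zero, nonpos_iff_eq_zero] at hsub
    simp [measureReal_def, hsub, failureBound, ← h0]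
  · set e := Real.exp (-(m * ((θ ^ 2)⁻¹ - Real.log (θ ^ 2)⁻¹ - 1))) with he
    have hterm : ∀ ℓ, P {ω | b / 2 ≤ combNorm (interference A S σ ℓ) (M ω)} ≤
        ENNReal.ofReal e := fun ℓ => by
      -- This factor brings the coefficient norm to at most 1 and the threshold `b / 2` to `θ⁻¹`.
      have hs : 0 < 2 / (b * θ) := by positivity
      refine le_trans (measure_mono fun ω hω => ?_)
        (htail (((2 / (b * θ) : ℝ) : ℂ) • interference A S σ ℓ) ?_ hpos hθ1)
      · rw [Set.mem_ofPred_eq] at hω ⊢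
        rw [combNorm_smul, Complex.norm_real, Real.norm_of_nonneg hs.le, ← inv_pow]
        refine pow_le_pow_left₀ (by positivity) ?_ 2
        calc θ⁻¹ = 2 / (b * θ) * (b / 2) := by field_simp
          _ ≤ _ := by gcongr
      · simp only [Pi.smul_apply, norm_smul, mul_pow, Complex.norm_real, Real.norm_eq_abs, sq_abs]
        rw [← Finset.mul_sum]
        calc _ ≤ (2 / (b * θ)) ^ 2 * (b * θ / 2) ^ 2 := by gcongr; exact hcoef ℓ
          _ = 1 := by field_simp
    have hfin : P {ω | SupportFails A S (coeffMatrix S σ (M ω))} ≤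
        ENNReal.ofReal (N * e) := by
      refine hsub.trans ((Finset.sum_le_sum fun ℓ _ => hterm ℓ).trans (le_of_eq ?_))
      rw [Finset.sum_const, Finset.card_univ, Fintype.card_fin, nsmul_eq_mul,
        ENNReal.ofReal_mul (Nat.cast_nonneg N), ENNReal.ofReal_natCast]
    rw [failureBound, if_neg hpos.ne']
    exact ENNReal.toReal_le_of_le_ofReal (by positivity) hfin

lemma ae_uniformSphere_norm_eq_one (E : Type*) [NormedAddCommGroup E] [NormedSpace ℝ E]
    [FiniteDimensional ℝ E] [MeasurableSpace E] [BorelSpace E] :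
    ∀ᵐ x ∂uniformSphere E, ‖x‖ = 1 := by
  rw [uniformSphere, ae_map_iff measurable_subtype_coe.aemeasurable
    (measurableSet_eq_fun (by fun_prop) measurable_const)]
  exact .of_forall fun u => norm_eq_of_mem_sphere u

lemma ae_norm_eq_one_of_hasLaw {E Ω : Type*} [NormedAddCommGroup E] [NormedSpace ℝ E]
    [FiniteDimensional ℝ E] [MeasurableSpace E] [BorelSpace E] [MeasurableSpace Ω]
    {P : Measure Ω} {X : Ω → E} (h : HasLaw X (uniformSphere E) P) : ∀ᵐ ω ∂P, ‖X ω‖ = 1 := by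
  have := ae_uniformSphere_norm_eq_one E
  rw [← h.map_eq] at this
  exact ae_of_ae_map h.aemeasurable this

end Recovery

end MultichannelThresholding

end

/-! ### The theorem for both models -/

open MultichannelThresholding in
theorem mainTheorem5 {n N L : ℕ} (hL : 1 ≤ L)
    (A : Matrix (Fin n) (Fin N) ℂ)
    (hA : ∀ j, ‖(WithLp.toLp 2 (A.col j) : EuclideanSpace ℂ (Fin n))‖ = 1)
    (S : Finset (Fin N)) (hS : S.Nonempty)
    (σ : S → ℝ) (hσ : ∀ j, 0 < σ j)
    (θ : ℝ) (hθ : θ = 2 * dynamicRange σ * localCoherence A S) (hθ1 : θ < 1)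
    {Ω : Type*} [MeasurableSpace Ω] (P : Measure Ω) [IsProbabilityMeasure P] :
    (∀ Φ : Ω → Matrix S (Fin L) ℝ, IsRealSpherical Φ P →
      P.real {ω | SupportFails A S (coeffMatrix S σ ((Φ ω).map Complex.ofReal))} ≤
          failureBound N (L / 2) θ ∧
        (LinearIndependent ℂ (fun j : S => A.col j) →
          P.real {ω | RecoveryFails A S.card (coeffMatrix S σ ((Φ ω).map Complex.ofReal))} ≤
            failureBound N (L / 2) θ)) ∧
    (∀ Φ : Ω → Matrix S (Fin L) ℂ, IsComplexSpherical Φ P →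
      P.real {ω | SupportFails A S (coeffMatrix S σ (Φ ω))} ≤ failureBound N L θ ∧
        (LinearIndependent ℂ (fun j : S => A.col j) →
          P.real {ω | RecoveryFails A S.card (coeffMatrix S σ (Φ ω))} ≤
            failureBound N L θ)) := by
  refine ⟨fun Φ hΦ => ?_, fun Φ hΦ => ?_⟩
  · have hM : ∀ᵐ ω ∂P, ∀ j, ‖(WithLp.toLp 2 ((Φ ω).map Complex.ofReal j) :
        EuclideanSpace ℂ (Fin L))‖ = 1 := by
      refine ae_all_iff.2 fun j => ?_
      filter_upwards [ae_norm_eq_one_of_hasLaw (hΦ.law j)] with ω hω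
      rw [← hω, EuclideanSpace.norm_eq, EuclideanSpace.norm_eq]
      simp
    have h := measureReal_supportFails_le hA hS hσ hθ hθ1 hM (m := L / 2)
      fun c hc h0 h1 => hΦ.meas_combNorm_sq_ge_le hL hc h0 h1
    exact ⟨h, fun hli => (measureReal_mono fun ω hω => hω.supportFails hli).trans h⟩
  · have hM : ∀ᵐ ω ∂P, ∀ j, ‖(WithLp.toLp 2 (Φ ω j) : EuclideanSpace ℂ (Fin L))‖ = 1 :=
      ae_all_iff.2 fun j => ae_norm_eq_one_of_hasLaw (hΦ.law j)
    have h := measureReal_supportFails_le hA hS hσ hθ hθ1 hM (m := L)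
      fun c hc h0 h1 => hΦ.meas_combNorm_sq_ge_le hL hc h0 h1
    exact ⟨h, fun hli => (measureReal_mono fun ω hω => hω.supportFails hli).trans h⟩
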